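/- Let $\mathcal X$ be a topological space with its Borel $\sigma$-algebra and let $d:\mathcal X\times\mathcal X\to[0,\infty)$ be a continuous symmetric function with $d(x,x')=0$ if and only if $x=x'$ (the triangle inequality is not required). We say that $(\mathcal X,d)$ is of \emph{negative type} if there are a Hilbert space $E$ and a map $\phi:\mathcal X\to E$ such that $d(x,x')=\|\phi(x)-\phi(x')\|_E^2$ for all $x,x'\in\mathcal X$. A Borel probability measure $\mu$ on $\mathcal X$ has \emph{finite first moment} with respect to $d$ if $\int d(x,x_0)\,\mathrm d\mu(x)<\infty$ for some $x_0\in\mathcal X$. We say that $(\mathcal X,d)$ is of \emph{strong negative type} if it is of negative type and, for all Borel probability measures $\mu_1,\mu_2$ on $\mathcal X$ with finite first moment with respect to $d$, $$D(\mu_1-\mu_2):=\int d\,\mathrm d(\mu_1\otimes\mu_1)-\int d\,\mathrm d(\mu_1\otimes\mu_2)-\int d\,\mathrm d(\mu_2\otimes\mu_1)+\int d\,\mathrm d(\mu_2\otimes\mu_2)=0$$ if and only if $\mu_1=\mu_2$. Let $(H,\|\cdot\|)$ be a separable real or complex Hilbert space. Then: 1. $H$ with the function $(x,x')\mapsto\|x-x'\|^\beta$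 is of negative type for every $\beta\in(0,2]$ and of strong negative type for every $\beta\in(0,2)$. 2. If $(\mathcal X,d)$ is a metric space that admits an isometric embedding into $H$, then $(\mathcal X,d^\beta)$ is of negative type for every $\beta\in(0,2]$ and of strong negative type for every $\beta\in(0,2)$. -/

import Mathlib

open MeasureTheory

universe u

/-- `(X, d)` is of negative type: there is a map `φ` from `X` to a (real) Hilbert space with
`d x x' = ‖φ x - φ x'‖ ^ 2`. (Complex Hilbert spaces give the same notion, by restriction of
scalars. The target may be taken in the universe of `X`, since it can always be replaced by the
closed linear span of the image of `φ`, with an arbitrary base point moved to the origin.) -/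
def IsOfNegativeType {X : Type u} (d : X → X → ℝ) : Prop :=
  ∃ (E : Type u) (_ : NormedAddCommGroup E) (_ : InnerProductSpace ℝ E) (_ : CompleteSpace E)
    (φ : X → E), ∀ x x' : X, d x x' = ‖φ x - φ x'‖ ^ 2

/-- `μ` has finite first moment with respect to `d`. -/
def HasFiniteFirstMoment {X : Type u} [MeasurableSpace X] (d : X → X → ℝ) (μ : Measure X) : Prop :=
  ∃ x₀ : X, Integrable (fun x => d x x₀) μ

/-- `∫ d(x, x') d(μ ⊗ ν)(x, x')`. For `ν = μ` this is `D(μ)`. -/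
noncomputable def mutualEnergy {X : Type u} [MeasurableSpace X] (d : X → X → ℝ)
    (μ ν : Measure X) : ℝ :=
  ∫ p : X × X, d p.1 p.2 ∂(μ.prod ν)

/-- `D(μ₁ - μ₂) = ∫ d(x, x') d((μ₁ - μ₂) ⊗ (μ₁ - μ₂))(x, x')`, the product of signed measures
being expanded bilinearly. -/
noncomputable def energyOfDifference {X : Type u} [MeasurableSpace X] (d : X → X → ℝ)
    (μ₁ μ₂ : Measure X) : ℝ :=
  mutualEnergy d μ₁ μ₁ - mutualEnergy d μ₁ μ₂ - mutualEnergy d μ₂ μ₁ + mutualEnergy d μ₂ μ₂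

/-- `(X, d)` is of strong negative type: it is of negative type, and for all probability measures
with finite first moment with respect to `d`, `D(μ₁ - μ₂) = 0` if and only if `μ₁ = μ₂`. -/
def IsOfStrongNegativeType {X : Type u} [MeasurableSpace X] (d : X → X → ℝ) : Prop :=
  IsOfNegativeType d ∧
    ∀ (μ₁ μ₂ : Measure X) [IsProbabilityMeasure μ₁] [IsProbabilityMeasure μ₂],
      HasFiniteFirstMoment d μ₁ → HasFiniteFirstMoment d μ₂ →
        (energyOfDifference d μ₁ μ₂ = 0 ↔ μ₁ = μ₂)

/-!
The argument compares `‖x - y‖ ^ β`, for `0 < β < 2`, with Gaussian kernels. With `α = β / 2` and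
`G s x y = exp (-s ‖x - y‖²)`, the substitution `s ↦ s t` in `∫₀^∞ s ^ (-1 - α) (1 - exp (-s t)) ds`
gives
`c ‖x - y‖ ^ β = ∫₀^∞ s ^ (-1 - α) (1 - G s x y) ds` with `c > 0`
(`integral_rpow_mul_one_sub_gaussianKernel`).

Each `G s` is positive semidefinite: up to the factors `exp (-s ‖x‖²)` and `exp (-s ‖y‖²)` it is the
power series `exp (2 s ⟪x, y⟫)`, to which the Schur product theorem applies. So it has a feature map
`Φ` into a reproducing kernel Hilbert space. Negative type follows: the kernel
`‖x‖ ^ β + ‖y‖ ^ β - ‖x - y‖ ^ β` is a positive mixture of the kernels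
`⟪Φ x - Φ 0, Φ y - Φ 0⟫`, and its own feature map, rescaled, is the required map. Exponent `2` is
immediate.

For strong negative type, Fubini's theorem turns the mixture of kernels into a mixture of energies
(`energyOfDifference_norm_sub_rpow`),
`c D(μ - ν) = -∫₀^∞ s ^ (-1 - α) ‖∫ Φ dμ - ∫ Φ dν‖² ds`.
If `D(μ - ν) = 0`, then for some `s > 0` the two mean embeddings agree, that is,
`∫ G s y x dμ(x) = ∫ G s y x dν(x)` for all `y`. Then `exp (-s ‖x‖²) μ` and `exp (-s ‖x‖²) ν` have
the same everywhere finite Laplace transform, hence by analytic continuation the same characteristic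
function, hence are equal (`ext_of_integral_gaussianKernel`).

Both properties pass to a metric space embedded in `H` by pull-back; since an isometry induces the
Borel structure, no information on the measures is lost.
-/

open Matrix Set ProbabilityTheory
open scoped InnerProductSpace ComplexOrder

/-! ### Positive semidefinite kernels and negative type -/

/-- Gram kernels are positive semidefinite, for an arbitrary (possibly infinite) index type. -/
lemma posSemidef_kernel_inner {X E : Type*} [NormedAddCommGroup E] [InnerProductSpace ℝ E]
    (φ : X → E) : (Matrix.of fun x y => ⟪φ x, φ y⟫_ℝ : Matrix X X ℝ).PosSemidef := by
  refine ⟨Matrix.IsHermitian.ext fun x y => by simp [real_inner_comm], fun c => ?_⟩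
  have h : (c.sum fun x a => c.sum fun y b => star a * ⟪φ x, φ y⟫_ℝ * b)
      = ⟪∑ x ∈ c.support, c x • φ x, ∑ x ∈ c.support, c x • φ x⟫_ℝ := by
    simp only [Finsupp.sum, sum_inner, inner_sum, inner_smul_left, inner_smul_right, star_trivial,
      RCLike.conj_to_real]
    refine Finset.sum_congr rfl fun x _ => ?_
    rw [Finset.mul_sum]
    exact Finset.sum_congr rfl fun y _ => by rw [real_inner_comm]; ring
  simp only [Matrix.of_apply, h]
  exact real_inner_self_nonneg

/-- Moore–Aronszajn: a positive semidefinite kernel is the Gram kernel of a map to a Hilbert space,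
which can be taken in the universe of the index type. -/
lemma Matrix.PosSemidef.exists_inner_eq {X : Type u} {K : Matrix X X ℝ} (hK : K.PosSemidef) :
    ∃ (E : Type u) (_ : NormedAddCommGroup E) (_ : InnerProductSpace ℝ E) (_ : CompleteSpace E)
      (φ : X → E), ∀ x y, ⟪φ x, φ y⟫_ℝ = K x y := by
  -- The vector-valued construction is applied to operators on `ℝ`, that is, multiplications.
  let K' : Matrix X X (ℝ →L[ℝ] ℝ) := .of fun x y => K x y • ContinuousLinearMap.id ℝ ℝ
  have hK' : K'.PosSemidef := by
    have h := (RKHS.posSemidef_tfae (K := K')).out 0 2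
    refine h.mpr ⟨?_, fun c => ?_⟩
    · refine Matrix.IsHermitian.ext fun x y => ?_
      have := hK.1.apply x y
      rw [star_trivial] at this
      have h1 : star (ContinuousLinearMap.id ℝ ℝ) = ContinuousLinearMap.id ℝ ℝ :=
        star_one (ℝ →L[ℝ] ℝ)
      simp [K', this, star_smul, h1]
    · have := hK.2 c
      rw [Finsupp.sum_comm] at this
      simp only [Finsupp.sum] at this ⊢
      refine this.trans_eq ?_
      simp [K']
      refine Finset.sum_congr rfl fun x _ => Finset.sum_congr rfl fun y _ => by ring
  have : Fact K'.PosSemidef := ⟨hK'⟩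
  refine ⟨RKHS.OfKernel K', inferInstance, inferInstance, inferInstance,
    fun x => RKHS.kerFun (RKHS.OfKernel K') x 1, fun x y => ?_⟩
  rw [← RKHS.kernel_inner, RKHS.OfKernel.kernel_ofKernel]
  simp [K', ← hK.1.apply x y]

/-- Squared distances along any map to an inner product space are of negative type. The target of
the map may lie in any universe and need not be complete: only its Gram kernel matters. -/
lemma isOfNegativeType_norm_sub_sq {X : Type u} {E : Type*} [NormedAddCommGroup E]
    [InnerProductSpace ℝ E] (φ : X → E) : IsOfNegativeType fun x y => ‖φ x - φ y‖ ^ 2 := by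
  obtain ⟨F, i1, i2, i3, ψ, hψ⟩ := (posSemidef_kernel_inner φ).exists_inner_eq
  refine ⟨F, i1, i2, i3, ψ, fun x y => ?_⟩
  simp only [Matrix.of_apply] at hψ
  beta_reduce
  rw [norm_sub_sq_real, norm_sub_sq_real]
  simp only [← real_inner_self_eq_norm_sq, hψ]

/-- Pull-back along a map, whatever the universes of its source and target. -/
lemma IsOfNegativeType.comp {X Y : Type*} {d : Y → Y → ℝ} (hd : IsOfNegativeType d) (f : X → Y) :
    IsOfNegativeType fun x x' => d (f x) (f x') := by
  obtain ⟨E, _, _, _, φ, hφ⟩ := hd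
  simp only [hφ]
  exact isOfNegativeType_norm_sub_sq fun x => φ (f x)

/-- The Schur product theorem for real kernels. -/
lemma posSemidef_mul {X : Type*} {K L : X → X → ℝ} (hK : (Matrix.of K).PosSemidef)
    (hL : (Matrix.of L).PosSemidef) : (Matrix.of fun x y => K x y * L x y).PosSemidef :=
  Matrix.PosSemidef.hadamard (𝕜 := ℝ) hK hL

/-- Pointwise sums of series of positive semidefinite kernels are positive semidefinite. -/
lemma posSemidef_of_hasSum {X ι : Type*} {K : ι → Matrix X X ℝ} {L : Matrix X X ℝ}
    (hK : ∀ i, (K i).PosSemidef) (h : ∀ x y, HasSum (fun i => K i x y) (L x y)) :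
    L.PosSemidef := by
  refine ⟨Matrix.IsHermitian.ext fun x y => ?_, fun c => ?_⟩
  · rw [star_trivial]
    refine (h y x).unique ?_
    convert h x y using 2 with i
    rw [← (hK i).1.apply y x, star_trivial]
  · refine HasSum.nonneg (L := SummationFilter.unconditional ι) (fun i => (hK i).2 c) ?_
    exact hasSum_sum fun x _ => hasSum_sum fun y _ => ((h x y).mul_left _).mul_right _

/-- Integrals of positive semidefinite kernels over a parameter are positive semidefinite. -/
lemma posSemidef_integral {X S : Type*} [MeasurableSpace S] {μ : Measure S}
    {K : S → Matrix X X ℝ} (hK : ∀ᵐ s ∂μ, (K s).PosSemidef)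
    (hint : ∀ x y, Integrable (fun s => K s x y) μ) :
    (Matrix.of fun x y => ∫ s, K s x y ∂μ).PosSemidef := by
  refine ⟨Matrix.IsHermitian.ext fun x y => ?_, fun c => ?_⟩
  · simp only [Matrix.of_apply, star_trivial]
    refine integral_congr_ae (hK.mono fun s hs => ?_)
    simpa using (hs.1.apply x y)
  · have h : (c.sum fun x a => c.sum fun y b => star a * (∫ s, K s x y ∂μ) * b)
        = ∫ s, (c.sum fun x a => c.sum fun y b => star a * K s x y * b) ∂μ := by
      simp only [Finsupp.sum]
      rw [integral_finsetSum _ fun x _ => integrable_finsetSum _ fun y _ =>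
        ((hint x y).const_mul _).mul_const _]
      refine Finset.sum_congr rfl fun x _ => ?_
      rw [integral_finsetSum _ fun y _ => ((hint x y).const_mul _).mul_const _]
      refine Finset.sum_congr rfl fun y _ => ?_
      rw [integral_mul_const, integral_const_mul]
    simp only [Matrix.of_apply, h]
    exact integral_nonneg_of_ae (hK.mono fun s hs => hs.2 c)

/-! ### The Gaussian kernel -/

/-- The Gaussian kernel `exp (-s ‖x - y‖²)`, with `s` the inverse squared width. -/
noncomputable def gaussianKernel {H : Type*} [NormedAddCommGroup H] (s : ℝ) (x y : H) : ℝ :=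
  Real.exp (-(s * ‖x - y‖ ^ 2))

lemma gaussianKernel_eq {H : Type*} [NormedAddCommGroup H] [InnerProductSpace ℝ H] (s : ℝ)
    (x y : H) : gaussianKernel s x y =
      Real.exp (-(s * ‖x‖ ^ 2)) * Real.exp (-(s * ‖y‖ ^ 2)) * Real.exp (2 * s * ⟪x, y⟫_ℝ) := by
  rw [gaussianKernel, ← Real.exp_add, ← Real.exp_add, norm_sub_sq_real]
  ring_nf

lemma posSemidef_gaussianKernel {H : Type*} [NormedAddCommGroup H] [InnerProductSpace ℝ H] {s : ℝ}
    (hs : 0 ≤ s) : (Matrix.of fun x y : H => gaussianKernel s x y).PosSemidef := by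
  have hpow (n : ℕ) : (Matrix.of fun x y : H => ⟪x, y⟫_ℝ ^ n).PosSemidef := by
    induction n with
    | zero => simpa using posSemidef_kernel_inner fun _ : H => (1 : ℝ)
    | succ n ih =>
      simp only [pow_succ]
      exact posSemidef_mul ih (posSemidef_kernel_inner (id : H → H))
  have hexp : (Matrix.of fun x y : H => Real.exp (2 * s * ⟪x, y⟫_ℝ)).PosSemidef := by
    refine posSemidef_of_hasSum (K := fun n : ℕ =>
      ((2 * s) ^ n / n.factorial) • Matrix.of fun x y : H => ⟪x, y⟫_ℝ ^ n)
      (fun n => (hpow n).smul (by positivity)) fun x y => ?_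
    have := NormedSpace.expSeries_div_hasSum_exp (𝔸 := ℝ) (2 * s * ⟪x, y⟫_ℝ)
    rw [← Real.exp_eq_exp_ℝ] at this
    simpa only [Matrix.smul_apply, Matrix.of_apply, smul_eq_mul, mul_pow, mul_div_right_comm]
      using this
  simp only [gaussianKernel_eq]
  refine posSemidef_mul ?_ hexp
  simpa [mul_comm] using posSemidef_kernel_inner fun x : H => Real.exp (-(s * ‖x‖ ^ 2))

lemma gaussianKernel_self {H : Type*} [NormedAddCommGroup H] (s : ℝ) (x : H) :
    gaussianKernel s x x = 1 := by simp [gaussianKernel]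

lemma gaussianKernel_comm {H : Type*} [NormedAddCommGroup H] (s : ℝ) (x y : H) :
    gaussianKernel s x y = gaussianKernel s y x := by simp [gaussianKernel, norm_sub_rev]

lemma gaussianKernel_pos {H : Type*} [NormedAddCommGroup H] (s : ℝ) (x y : H) :
    0 < gaussianKernel s x y := Real.exp_pos _

lemma gaussianKernel_le_one {H : Type*} [NormedAddCommGroup H] {s : ℝ} (hs : 0 ≤ s) (x y : H) :
    gaussianKernel s x y ≤ 1 := by
  simp only [gaussianKernel, Real.exp_le_one_iff, Left.neg_nonpos_iff]
  positivity

lemma norm_gaussianKernel_le {H : Type*} [NormedAddCommGroup H] {s : ℝ} (hs : 0 ≤ s) (x y : H) :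
    ‖gaussianKernel s x y‖ ≤ 1 := by
  rw [Real.norm_of_nonneg (gaussianKernel_pos s x y).le]
  exact gaussianKernel_le_one hs x y

lemma exists_inner_eq_gaussianKernel {H : Type u} [NormedAddCommGroup H] [InnerProductSpace ℝ H]
    {s : ℝ} (hs : 0 ≤ s) :
    ∃ (E : Type u) (_ : NormedAddCommGroup E) (_ : InnerProductSpace ℝ E) (_ : CompleteSpace E)
      (Φ : H → E), ∀ x y, ⟪Φ x, Φ y⟫_ℝ = gaussianKernel s x y :=
  (posSemidef_gaussianKernel hs).exists_inner_eq

/-! ### Powers of the distance as mixtures of Gaussian kernels -/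

/-- The integrand is at most `s ^ (-α)` on `(0, 1]` and at most `s ^ (-1 - α)` on `(1, ∞)`. -/
lemma integrableOn_rpow_mul_one_sub_exp_neg {α : ℝ} (h0 : 0 < α) (h1 : α < 1) :
    IntegrableOn (fun s : ℝ => s ^ (-1 - α) * (1 - Real.exp (-s))) (Ioi 0) := by
  have hmeas : Measurable fun s : ℝ => s ^ (-1 - α) * (1 - Real.exp (-s)) := by fun_prop
  rw [← Ioc_union_Ioi_eq_Ioi (zero_le_one' ℝ)]
  refine IntegrableOn.union ?_ ?_
  · have h : IntegrableOn (fun s : ℝ => s ^ (-α)) (Ioc 0 1) :=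
      (intervalIntegrable_iff_integrableOn_Ioc_of_le zero_le_one).1
        (intervalIntegral.intervalIntegrable_rpow' (by linarith))
    refine h.mono' hmeas.aestronglyMeasurable ?_
    refine (ae_restrict_iff' measurableSet_Ioc).2 (.of_forall fun s hs => ?_)
    have h2 : Real.exp (-s) ≤ 1 := by simpa using hs.1.le
    have h3 := Real.add_one_le_exp (-s)
    have h4 := Real.rpow_pos_of_pos hs.1 (-1 - α)
    rw [Real.norm_of_nonneg (mul_nonneg h4.le (by linarith))]
    calc s ^ (-1 - α) * (1 - Real.exp (-s)) ≤ s ^ (-1 - α) * s := by gcongr; linarith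
      _ = s ^ (-α) := by rw [← Real.rpow_add_one hs.1.ne']; ring_nf
  · refine (integrableOn_Ioi_rpow_of_lt (a := -1 - α) (by linarith) zero_lt_one).mono'
      hmeas.aestronglyMeasurable ?_
    refine (ae_restrict_iff' measurableSet_Ioi).2 (.of_forall fun s hs => ?_)
    have hs' : 0 < s := zero_lt_one.trans hs
    have h2 : Real.exp (-s) ≤ 1 := by simpa using hs'.le
    have h4 := Real.rpow_pos_of_pos hs' (-1 - α)
    rw [Real.norm_of_nonneg (mul_nonneg h4.le (by linarith))]
    exact mul_le_of_le_one_right h4.le (by linarith [Real.exp_pos (-s)])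

/-- The normalizing constant `∫₀^∞ s ^ (-1 - α) (1 - exp (-s)) ds`, convergent for `0 < α < 1`. -/
noncomputable def powerConst (α : ℝ) : ℝ :=
  ∫ s in Ioi (0 : ℝ), s ^ (-1 - α) * (1 - Real.exp (-s))

lemma powerConst_pos {α : ℝ} (h0 : 0 < α) (h1 : α < 1) : 0 < powerConst α := by
  have hpos : ∀ s ∈ Ioi (0 : ℝ), 0 < s ^ (-1 - α) * (1 - Real.exp (-s)) := fun s hs =>
    mul_pos (Real.rpow_pos_of_pos hs _) (by simpa using hs)
  rw [powerConst, setIntegral_pos_iff_support_of_nonneg_ae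
    ((ae_restrict_iff' measurableSet_Ioi).2 (.of_forall fun s hs => (hpos s hs).le))
    (integrableOn_rpow_mul_one_sub_exp_neg h0 h1)]
  refine lt_of_lt_of_le ?_ (measure_mono (subset_inter (fun s hs => (hpos s hs).ne') subset_rfl))
  simp

lemma rpow_mul_one_sub_exp_neg_mul {α t s : ℝ} (ht : 0 < t) (hs : 0 < s) :
    s ^ (-1 - α) * (1 - Real.exp (-(s * t)))
      = t ^ (1 + α) * ((t * s) ^ (-1 - α) * (1 - Real.exp (-(t * s)))) := by
  have h : t ^ (1 + α) * t ^ (-1 - α) = 1 := by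
    rw [← Real.rpow_add ht]; simp
  rw [Real.mul_rpow ht.le hs.le, mul_comm s t]
  linear_combination (-(s ^ (-1 - α) * (1 - Real.exp (-(t * s))))) * h

lemma integrableOn_rpow_mul_one_sub_exp_neg_mul {α : ℝ} (h0 : 0 < α) (h1 : α < 1) {t : ℝ}
    (ht : 0 ≤ t) :
    IntegrableOn (fun s : ℝ => s ^ (-1 - α) * (1 - Real.exp (-(s * t)))) (Ioi 0) := by
  rcases ht.eq_or_lt with rfl | ht
  · simp
  refine IntegrableOn.congr_fun ?_ (fun s hs => (rpow_mul_one_sub_exp_neg_mul ht hs).symm)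
    measurableSet_Ioi
  refine Integrable.const_mul ?_ _
  have := (integrableOn_Ioi_comp_mul_left_iff
    (fun s : ℝ => s ^ (-1 - α) * (1 - Real.exp (-s))) 0 ht).2
  rw [mul_zero] at this
  exact this (integrableOn_rpow_mul_one_sub_exp_neg h0 h1)

/-- The representation of `t ^ α` as a mixture of the functions `1 - exp (-s t)`. -/
lemma integral_rpow_mul_one_sub_exp_neg_mul {α : ℝ} (h0 : 0 < α) {t : ℝ} (ht : 0 ≤ t) :
    ∫ s in Ioi (0 : ℝ), s ^ (-1 - α) * (1 - Real.exp (-(s * t))) = powerConst α * t ^ α := by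
  rcases ht.eq_or_lt with rfl | ht
  · simp [Real.zero_rpow h0.ne']
  rw [setIntegral_congr_fun measurableSet_Ioi fun s hs => rpow_mul_one_sub_exp_neg_mul ht hs,
    integral_const_mul, integral_comp_mul_left_Ioi
      (fun s : ℝ => s ^ (-1 - α) * (1 - Real.exp (-s))) 0 ht, mul_zero, smul_eq_mul, ← mul_assoc,
    Real.rpow_add ht, Real.rpow_one, powerConst]
  field_simp

lemma norm_sq_rpow_half {H : Type*} [NormedAddCommGroup H] (β : ℝ) (x : H) :
    (‖x‖ ^ 2) ^ (β / 2) = ‖x‖ ^ β := by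
  rw [← Real.rpow_natCast, ← Real.rpow_mul (norm_nonneg x)]
  congr 1
  push_cast
  ring

lemma integrableOn_rpow_mul_one_sub_gaussianKernel {H : Type*} [NormedAddCommGroup H] {β : ℝ}
    (h0 : 0 < β) (h2 : β < 2) (x y : H) :
    IntegrableOn (fun s : ℝ => s ^ (-1 - β / 2) * (1 - gaussianKernel s x y)) (Ioi 0) :=
  integrableOn_rpow_mul_one_sub_exp_neg_mul (by linarith) (by linarith) (sq_nonneg _)

/-- `‖x - y‖ ^ β` as a mixture of Gaussian kernels of varying width. -/
lemma integral_rpow_mul_one_sub_gaussianKernel {H : Type*} [NormedAddCommGroup H] {β : ℝ}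
    (h0 : 0 < β) (x y : H) :
    ∫ s in Ioi (0 : ℝ), s ^ (-1 - β / 2) * (1 - gaussianKernel s x y)
      = powerConst (β / 2) * ‖x - y‖ ^ β := by
  rw [← norm_sq_rpow_half, ← integral_rpow_mul_one_sub_exp_neg_mul (by linarith) (sq_nonneg _)]
  rfl

/-- The kernel centred at `0` that is associated with `‖x - y‖ ^ β`, up to a positive factor. -/
lemma posSemidef_norm_rpow_add_sub {H : Type*} [NormedAddCommGroup H] [InnerProductSpace ℝ H]
    {β : ℝ} (h0 : 0 < β) (h2 : β < 2) :
    (Matrix.of fun x y : H => powerConst (β / 2) *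
      (‖x‖ ^ β + ‖y‖ ^ β - ‖x - y‖ ^ β)).PosSemidef := by
  have hI := fun x y : H => integrableOn_rpow_mul_one_sub_gaussianKernel h0 h2 x y
  have key := posSemidef_integral (μ := volume.restrict (Ioi (0 : ℝ)))
    (K := fun s => Matrix.of fun x y : H =>
      s ^ (-1 - β / 2) * (1 - gaussianKernel s x 0) + s ^ (-1 - β / 2) * (1 - gaussianKernel s y 0)
        - s ^ (-1 - β / 2) * (1 - gaussianKernel s x y)) ?_
    (fun x y => ((hI x 0).add (hI y 0)).sub (hI x y))
  · convert key using 1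
    ext x y
    simp only [Matrix.of_apply]
    rw [integral_sub ((hI x 0).fun_add (hI y 0)) (hI x y), integral_add (hI x 0) (hI y 0)]
    simp only [integral_rpow_mul_one_sub_gaussianKernel h0, sub_zero]
    ring
  · refine (ae_restrict_iff' measurableSet_Ioi).2 (.of_forall fun s (hs : 0 < s) => ?_)
    obtain ⟨E, _, _, _, Φ, hΦ⟩ := exists_inner_eq_gaussianKernel (H := H) hs.le
    have h := (posSemidef_kernel_inner fun x => Φ x - Φ 0).smul
      (Real.rpow_nonneg hs.le (-1 - β / 2))
    convert h using 1
    ext x y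
    simp only [Matrix.of_apply, Matrix.smul_apply, smul_eq_mul, inner_sub_left, inner_sub_right, hΦ,
      gaussianKernel_self, gaussianKernel_comm s (0 : H) y]
    ring

lemma isOfNegativeType_norm_sub_rpow {H : Type*} [NormedAddCommGroup H] [InnerProductSpace ℝ H]
    {β : ℝ} (h0 : 0 < β) (h2 : β ≤ 2) : IsOfNegativeType fun x y : H => ‖x - y‖ ^ β := by
  rcases h2.eq_or_lt with rfl | h2
  · simpa using isOfNegativeType_norm_sub_sq (id : H → H)
  have hC := powerConst_pos (α := β / 2) (by linarith) (by linarith)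
  obtain ⟨E, i1, i2, i3, φ, hφ⟩ := ((posSemidef_norm_rpow_add_sub (H := H) h0 h2).smul
    (inv_nonneg.2 (mul_pos two_pos hC).le)).exists_inner_eq
  refine ⟨E, i1, i2, i3, φ, fun x y => ?_⟩
  rw [norm_sub_sq_real, ← real_inner_self_eq_norm_sq, ← real_inner_self_eq_norm_sq, hφ, hφ, hφ]
  simp only [Matrix.smul_apply, Matrix.of_apply, smul_eq_mul, sub_self, norm_zero,
    Real.zero_rpow h0.ne']
  field_simp
  ring

/-! ### Gaussian energies and mean embeddings -/

lemma continuous_gaussianKernel {H : Type*} [NormedAddCommGroup H] (s : ℝ) :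
    Continuous fun p : H × H => gaussianKernel s p.1 p.2 := by
  unfold gaussianKernel; fun_prop

lemma integrable_gaussianKernel {H : Type*} [NormedAddCommGroup H] [SecondCountableTopology H]
    [MeasurableSpace H] [BorelSpace H] {s : ℝ} (hs : 0 ≤ s) (μ : Measure (H × H))
    [IsFiniteMeasure μ] :
    Integrable (fun p => gaussianKernel s p.1 p.2) μ :=
  .of_bound (continuous_gaussianKernel s).aestronglyMeasurable 1
    (.of_forall fun p => norm_gaussianKernel_le hs p.1 p.2)

/-- A feature map of the Gaussian kernel is bounded and continuous, so it has a mean (Bochner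
integral) under every finite measure. -/
lemma integrable_of_inner_eq_gaussianKernel {H : Type*} [NormedAddCommGroup H]
    [SecondCountableTopology H] [MeasurableSpace H] [BorelSpace H] {s : ℝ} {E : Type*}
    [NormedAddCommGroup E] [InnerProductSpace ℝ E] {Φ : H → E} (hΦ : ∀ x y, ⟪Φ x, Φ y⟫_ℝ = gaussianKernel s x y)
    (μ : Measure H) [IsFiniteMeasure μ] : Integrable Φ μ := by
  have hcont : Continuous Φ := by
    rw [continuous_iff_continuousAt]
    intro x
    rw [ContinuousAt, tendsto_iff_norm_sub_tendsto_zero]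
    have h (y : H) : ‖Φ y - Φ x‖ = √(2 - 2 * gaussianKernel s y x) := by
      rw [← Real.sqrt_sq (norm_nonneg (Φ y - Φ x)), norm_sub_sq_real,
        ← real_inner_self_eq_norm_sq, ← real_inner_self_eq_norm_sq, hΦ, hΦ, hΦ,
        gaussianKernel_self, gaussianKernel_self]
      ring_nf
    simp only [h]
    have hc : Continuous fun y => √(2 - 2 * gaussianKernel s y x) := by
      unfold gaussianKernel; fun_prop
    simpa [gaussianKernel_self] using hc.tendsto x
  refine .of_bound hcont.aestronglyMeasurable 1 (.of_forall fun x => ?_)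
  rw [← sq_le_one_iff₀ (norm_nonneg _), ← real_inner_self_eq_norm_sq, hΦ, gaussianKernel_self]

section GaussianEnergy

variable {H : Type*} [NormedAddCommGroup H] [SecondCountableTopology H] [MeasurableSpace H]
  [BorelSpace H] {s : ℝ}

/-- The mutual Gaussian energy is the inner product of the mean embeddings. -/
lemma mutualEnergy_gaussianKernel {E : Type*} [NormedAddCommGroup E] [InnerProductSpace ℝ E]
    [CompleteSpace E] (hs : 0 ≤ s) {Φ : H → E}
    (hΦ : ∀ x y, ⟪Φ x, Φ y⟫_ℝ = gaussianKernel s x y) (μ ν : Measure H) [IsFiniteMeasure μ]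
    [IsFiniteMeasure ν] :
    mutualEnergy (gaussianKernel s) μ ν = ⟪∫ x, Φ x ∂μ, ∫ x, Φ x ∂ν⟫_ℝ := by
  rw [mutualEnergy, integral_prod _ (integrable_gaussianKernel hs _)]
  simp only [← hΦ]
  simp only [integral_inner (integrable_of_inner_eq_gaussianKernel hΦ ν)]
  rw [real_inner_comm, ← integral_inner (integrable_of_inner_eq_gaussianKernel hΦ μ)]
  exact integral_congr_ae (.of_forall fun x => real_inner_comm _ _)

/-- The Gaussian energy of `μ - ν` is the squared distance of the mean embeddings. -/
lemma energyOfDifference_gaussianKernel {E : Type*} [NormedAddCommGroup E] [InnerProductSpace ℝ E]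
    [CompleteSpace E] (hs : 0 ≤ s) {Φ : H → E}
    (hΦ : ∀ x y, ⟪Φ x, Φ y⟫_ℝ = gaussianKernel s x y) (μ ν : Measure H) [IsFiniteMeasure μ]
    [IsFiniteMeasure ν] :
    energyOfDifference (gaussianKernel s) μ ν = ‖(∫ x, Φ x ∂μ) - ∫ x, Φ x ∂ν‖ ^ 2 := by
  simp only [energyOfDifference, mutualEnergy_gaussianKernel hs hΦ, ← real_inner_self_eq_norm_sq,
    inner_sub_left, inner_sub_right]
  ring

variable [InnerProductSpace ℝ H]

lemma energyOfDifference_gaussianKernel_nonneg (hs : 0 ≤ s) (μ ν : Measure H) [IsFiniteMeasure μ]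
    [IsFiniteMeasure ν] : 0 ≤ energyOfDifference (gaussianKernel s) μ ν := by
  obtain ⟨E, _, _, _, Φ, hΦ⟩ := exists_inner_eq_gaussianKernel (H := H) hs
  rw [energyOfDifference_gaussianKernel hs hΦ]
  positivity

lemma integral_gaussianKernel_eq_of_energyOfDifference_eq_zero (hs : 0 ≤ s) {μ ν : Measure H}
    [IsFiniteMeasure μ] [IsFiniteMeasure ν]
    (h : energyOfDifference (gaussianKernel s) μ ν = 0) (y : H) :
    ∫ x, gaussianKernel s y x ∂μ = ∫ x, gaussianKernel s y x ∂ν := by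
  obtain ⟨E, _, _, _, Φ, hΦ⟩ := exists_inner_eq_gaussianKernel (H := H) hs
  rw [energyOfDifference_gaussianKernel hs hΦ, sq_eq_zero_iff, norm_eq_zero, sub_eq_zero] at h
  simp only [← hΦ]
  rw [integral_inner (integrable_of_inner_eq_gaussianKernel hΦ μ),
    integral_inner (integrable_of_inner_eq_gaussianKernel hΦ ν), h]

/-- Finite measures on a separable Hilbert space with equal, everywhere finite Laplace transforms
coincide: the Laplace transforms along each direction extend to entire functions, whose values on
the imaginary axis give the characteristic function. -/
lemma ext_of_mgf_inner [CompleteSpace H] {μ ν : Measure H} [IsFiniteMeasure μ] [IsFiniteMeasure ν]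
    (hint : ∀ v t, Integrable (fun x => Real.exp (t * ⟪x, v⟫_ℝ)) μ)
    (h : ∀ v : H, mgf (fun x => ⟪x, v⟫_ℝ) μ = mgf (fun x => ⟪x, v⟫_ℝ) ν) : μ = ν := by
  refine Measure.ext_of_charFun (funext fun v => ?_)
  have h0 : μ = 0 ↔ ν = 0 := by
    have := congrFun (h v) 0
    simp only [mgf_zero'] at this
    rw [← Measure.measure_univ_eq_zero, ← Measure.measure_univ_eq_zero (μ := ν),
      ← measureReal_eq_zero_iff, ← measureReal_eq_zero_iff, this]
  have hset : integrableExpSet (fun x => ⟪x, v⟫_ℝ) μ = univ := eq_univ_of_forall (hint v)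
  have key := eqOn_complexMGF_of_mgf' (h v) h0 (x := Complex.I) (by simp [hset])
  simpa [complexMGF, charFun, mul_comm] using key

/-- The Gaussian kernel is characteristic: its mean embedding separates finite measures. Multiplying
the measures by `exp (-s ‖x‖²)` turns the mean embedding into the Laplace transform. -/
lemma ext_of_integral_gaussianKernel [CompleteSpace H] (hs : 0 < s) {μ ν : Measure H}
    [IsFiniteMeasure μ] [IsFiniteMeasure ν]
    (h : ∀ y, ∫ x, gaussianKernel s y x ∂μ = ∫ x, gaussianKernel s y x ∂ν) : μ = ν := by
  let g : H → ENNReal := fun x => ENNReal.ofReal (Real.exp (-(s * ‖x‖ ^ 2)))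
  have hg : Measurable g := by unfold g; fun_prop
  -- Completing the square with `y = (t / (2 s)) v` makes `2 s ⟪y, x⟫` equal to `t ⟪x, v⟫`.
  have hexp (v : H) (t : ℝ) (x : H) :
      Real.exp (-(s * ‖x‖ ^ 2)) * Real.exp (t * ⟪x, v⟫_ℝ)
        = Real.exp (s * ‖(t / (2 * s)) • v‖ ^ 2) * gaussianKernel s ((t / (2 * s)) • v) x := by
    rw [gaussianKernel_eq, inner_smul_left, real_inner_comm]
    simp only [← Real.exp_add, RCLike.conj_to_real]
    congr 1
    field_simp
    ring
  have hint (ρ : Measure H) [IsFiniteMeasure ρ] (v : H) (t : ℝ) :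
      Integrable (fun x => Real.exp (t * ⟪x, v⟫_ℝ)) (ρ.withDensity g) := by
    rw [integrable_withDensity_iff_integrable_smul' hg (by simp [g])]
    simp only [g, ENNReal.toReal_ofReal (Real.exp_pos _).le, smul_eq_mul, hexp]
    refine Integrable.const_mul (.of_bound ?_ 1
      (.of_forall fun x => norm_gaussianKernel_le hs.le _ x)) _
    have hc (y : H) : Continuous fun x => gaussianKernel s y x := by
      unfold gaussianKernel; fun_prop
    exact (hc _).aestronglyMeasurable
  have hmgf (ρ : Measure H) [IsFiniteMeasure ρ] (v : H) (t : ℝ) :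
      mgf (fun x => ⟪x, v⟫_ℝ) (ρ.withDensity g) t = Real.exp (s * ‖(t / (2 * s)) • v‖ ^ 2) *
        ∫ x, gaussianKernel s ((t / (2 * s)) • v) x ∂ρ := by
    rw [mgf, integral_withDensity_eq_integral_toReal_smul hg (by simp [g])]
    simp only [g, ENNReal.toReal_ofReal (Real.exp_pos _).le, smul_eq_mul, hexp,
      integral_const_mul]
  have hfin (ρ : Measure H) [IsFiniteMeasure ρ] : IsFiniteMeasure (ρ.withDensity g) := by
    have := hint ρ 0 0
    simp only [zero_mul, Real.exp_zero] at this
    exact (integrable_const_iff_isFiniteMeasure one_ne_zero).1 this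
  have := hfin μ
  have := hfin ν
  have key : μ.withDensity g = ν.withDensity g :=
    ext_of_mgf_inner (hint μ) fun v => funext fun t => by rw [hmgf, hmgf, h]
  have hinv (ρ : Measure H) : (ρ.withDensity g).withDensity g⁻¹ = ρ :=
    withDensity_inv_same hg (.of_forall fun x => by simp [g, Real.exp_pos])
      (.of_forall fun x => by simp [g])
  rw [← hinv μ, key, hinv ν]

end GaussianEnergy

/-! ### Energies of powers of the distance -/

section Power

lemma measurable_norm_sub_rpow {H : Type*} [NormedAddCommGroup H] [SecondCountableTopology H]
    [MeasurableSpace H] [BorelSpace H] (β : ℝ) :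
    Measurable fun p : H × H => ‖p.1 - p.2‖ ^ β := by
  fun_prop

/-- For a function of negative type, finite first moments make the mutual energy an honest
integral: `d x y ≤ 3 (d x x₀ + d x₀ y₀ + d y₀ y)`, although `d` need not satisfy the
triangle inequality. -/
lemma IsOfNegativeType.integrable_prod {X : Type*} [MeasurableSpace X] {d : X → X → ℝ}
    (hd : IsOfNegativeType d) (hmeas : Measurable fun p : X × X => d p.1 p.2) {μ ν : Measure X}
    [IsFiniteMeasure μ] [IsFiniteMeasure ν] (hμ : HasFiniteFirstMoment d μ)
    (hν : HasFiniteFirstMoment d ν) : Integrable (fun p : X × X => d p.1 p.2) (μ.prod ν) := by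
  obtain ⟨E, _, _, _, φ, hφ⟩ := hd
  obtain ⟨x₀, hx₀⟩ := hμ
  obtain ⟨y₀, hy₀⟩ := hν
  refine (((hx₀.comp_fst ν).fun_add ((hy₀.comp_snd μ).fun_add
    (integrable_const (d x₀ y₀)))).const_mul 3).mono' hmeas.aestronglyMeasurable
    (.of_forall fun p => ?_)
  simp only [hφ, norm_pow, norm_norm]
  have h1 : ‖φ p.1 - φ p.2‖ ≤ ‖φ p.1 - φ x₀‖ + ‖φ p.2 - φ y₀‖ + ‖φ x₀ - φ y₀‖ := by
    calc ‖φ p.1 - φ p.2‖ = ‖(φ p.1 - φ x₀) - (φ p.2 - φ y₀) + (φ x₀ - φ y₀)‖ := by congr 1; abel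
      _ ≤ _ := (norm_add_le _ _).trans (by gcongr; exact norm_sub_le _ _)
  have h2 := pow_le_pow_left₀ (norm_nonneg _) h1 2
  nlinarith [sq_nonneg (‖φ p.1 - φ x₀‖ - ‖φ p.2 - φ y₀‖),
    sq_nonneg (‖φ p.1 - φ x₀‖ - ‖φ x₀ - φ y₀‖),
    sq_nonneg (‖φ p.2 - φ y₀‖ - ‖φ x₀ - φ y₀‖)]

variable {H : Type*} [NormedAddCommGroup H] [SecondCountableTopology H] [MeasurableSpace H]
  [BorelSpace H] {β : ℝ}

lemma integral_one_sub_gaussianKernel {s : ℝ} (hs : 0 ≤ s) (μ ν : Measure H)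
    [IsProbabilityMeasure μ] [IsProbabilityMeasure ν] :
    ∫ p : H × H, s ^ (-1 - β / 2) * (1 - gaussianKernel s p.1 p.2) ∂(μ.prod ν)
      = s ^ (-1 - β / 2) * (1 - mutualEnergy (gaussianKernel s) μ ν) := by
  rw [integral_const_mul, integral_sub (integrable_const _) (integrable_gaussianKernel hs _)]
  simp [mutualEnergy]

variable [InnerProductSpace ℝ H]

/-- Integrability for Fubini's theorem: integrating out `s` first leaves a multiple of
`‖x - y‖ ^ β`, which is integrable by the moment condition. -/
lemma integrable_prod_rpow_mul_one_sub_gaussianKernel (h0 : 0 < β) (h2 : β < 2)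
    {μ ν : Measure H} [IsProbabilityMeasure μ] [IsProbabilityMeasure ν]
    (hμ : HasFiniteFirstMoment (fun x y : H => ‖x - y‖ ^ β) μ)
    (hν : HasFiniteFirstMoment (fun x y : H => ‖x - y‖ ^ β) ν) :
    Integrable (fun q : ℝ × (H × H) => q.1 ^ (-1 - β / 2) * (1 - gaussianKernel q.1 q.2.1 q.2.2))
      ((volume.restrict (Ioi (0 : ℝ))).prod (μ.prod ν)) := by
  have hmeas : Measurable fun q : ℝ × (H × H) =>
      q.1 ^ (-1 - β / 2) * (1 - gaussianKernel q.1 q.2.1 q.2.2) := by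
    unfold gaussianKernel; fun_prop
  rw [integrable_prod_iff' hmeas.aestronglyMeasurable]
  refine ⟨.of_forall fun p => integrableOn_rpow_mul_one_sub_gaussianKernel h0 h2 p.1 p.2, ?_⟩
  have hd := (isOfNegativeType_norm_sub_rpow (H := H) h0 h2.le).integrable_prod
    (measurable_norm_sub_rpow β) hμ hν
  refine (hd.const_mul (powerConst (β / 2))).congr (.of_forall fun p => ?_)
  simp only [← integral_rpow_mul_one_sub_gaussianKernel h0]
  refine setIntegral_congr_fun measurableSet_Ioi fun s (hs : 0 < s) => ?_
  refine (Real.norm_of_nonneg (mul_nonneg (Real.rpow_nonneg hs.le _) ?_)).symm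
  linarith [gaussianKernel_le_one hs.le p.1 p.2]

lemma integrableOn_rpow_mul_one_sub_mutualEnergy (h0 : 0 < β) (h2 : β < 2)
    {μ ν : Measure H} [IsProbabilityMeasure μ] [IsProbabilityMeasure ν]
    (hμ : HasFiniteFirstMoment (fun x y : H => ‖x - y‖ ^ β) μ)
    (hν : HasFiniteFirstMoment (fun x y : H => ‖x - y‖ ^ β) ν) :
    IntegrableOn (fun s : ℝ => s ^ (-1 - β / 2) * (1 - mutualEnergy (gaussianKernel s) μ ν))
      (Ioi 0) :=
  IntegrableOn.congr_fun
    (integrable_prod_rpow_mul_one_sub_gaussianKernel h0 h2 hμ hν).integral_prod_left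
    (fun _ hs => integral_one_sub_gaussianKernel (le_of_lt hs) μ ν) measurableSet_Ioi

lemma mutualEnergy_norm_sub_rpow (h0 : 0 < β) (h2 : β < 2)
    {μ ν : Measure H} [IsProbabilityMeasure μ] [IsProbabilityMeasure ν]
    (hμ : HasFiniteFirstMoment (fun x y : H => ‖x - y‖ ^ β) μ)
    (hν : HasFiniteFirstMoment (fun x y : H => ‖x - y‖ ^ β) ν) :
    powerConst (β / 2) * mutualEnergy (fun x y : H => ‖x - y‖ ^ β) μ ν
      = ∫ s in Ioi (0 : ℝ), s ^ (-1 - β / 2) * (1 - mutualEnergy (gaussianKernel s) μ ν) := by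
  rw [mutualEnergy, ← integral_const_mul]
  simp only [← integral_rpow_mul_one_sub_gaussianKernel h0]
  rw [← integral_integral_swap
    (integrable_prod_rpow_mul_one_sub_gaussianKernel h0 h2 hμ hν)]
  exact setIntegral_congr_fun measurableSet_Ioi fun s hs =>
    integral_one_sub_gaussianKernel (le_of_lt hs) μ ν

/-- Up to sign, the energy of `μ - ν` of exponent `β` is a mixture of Gaussian ones: the constant
terms `1 - 1 - 1 + 1` cancel. -/
lemma energyOfDifference_norm_sub_rpow (h0 : 0 < β) (h2 : β < 2)
    {μ ν : Measure H} [IsProbabilityMeasure μ] [IsProbabilityMeasure ν]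
    (hμ : HasFiniteFirstMoment (fun x y : H => ‖x - y‖ ^ β) μ)
    (hν : HasFiniteFirstMoment (fun x y : H => ‖x - y‖ ^ β) ν) :
    IntegrableOn (fun s : ℝ => s ^ (-1 - β / 2) * energyOfDifference (gaussianKernel s) μ ν)
      (Ioi 0) ∧
    powerConst (β / 2) * energyOfDifference (fun x y : H => ‖x - y‖ ^ β) μ ν
      = -∫ s in Ioi (0 : ℝ), s ^ (-1 - β / 2) * energyOfDifference (gaussianKernel s) μ ν := by
  have i11 := integrableOn_rpow_mul_one_sub_mutualEnergy h0 h2 hμ hμ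
  have i12 := integrableOn_rpow_mul_one_sub_mutualEnergy h0 h2 hμ hν
  have i21 := integrableOn_rpow_mul_one_sub_mutualEnergy h0 h2 hν hμ
  have i22 := integrableOn_rpow_mul_one_sub_mutualEnergy h0 h2 hν hν
  have heq (s : ℝ) : s ^ (-1 - β / 2) * energyOfDifference (gaussianKernel s) μ ν
      = -(s ^ (-1 - β / 2) * (1 - mutualEnergy (gaussianKernel s) μ μ)
        - s ^ (-1 - β / 2) * (1 - mutualEnergy (gaussianKernel s) μ ν)
        - s ^ (-1 - β / 2) * (1 - mutualEnergy (gaussianKernel s) ν μ)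
        + s ^ (-1 - β / 2) * (1 - mutualEnergy (gaussianKernel s) ν ν)) := by
    rw [energyOfDifference]; ring
  simp only [heq]
  refine ⟨(((i11.sub i12).sub i21).add i22).neg, ?_⟩
  rw [integral_neg, neg_neg, integral_add ((i11.fun_sub i12).fun_sub i21) i22,
    integral_sub (i11.fun_sub i12) i21, integral_sub i11 i12,
    ← mutualEnergy_norm_sub_rpow h0 h2 hμ hμ, ← mutualEnergy_norm_sub_rpow h0 h2 hμ hν,
    ← mutualEnergy_norm_sub_rpow h0 h2 hν hμ, ← mutualEnergy_norm_sub_rpow h0 h2 hν hν,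
    energyOfDifference]
  ring

lemma isOfStrongNegativeType_norm_sub_rpow [CompleteSpace H] (h0 : 0 < β) (h2 : β < 2) :
    IsOfStrongNegativeType fun x y : H => ‖x - y‖ ^ β := by
  refine ⟨isOfNegativeType_norm_sub_rpow h0 h2.le, fun μ ν _ _ hμ hν => ⟨fun h => ?_, ?_⟩⟩
  · obtain ⟨hint, heq⟩ := energyOfDifference_norm_sub_rpow h0 h2 hμ hν
    rw [h, mul_zero, eq_comm, neg_eq_zero, setIntegral_eq_zero_iff_of_nonneg_ae
      ((ae_restrict_iff' measurableSet_Ioi).2 (.of_forall fun s (hs : 0 < s) => mul_nonneg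
        (Real.rpow_nonneg hs.le _) (energyOfDifference_gaussianKernel_nonneg hs.le μ ν))) hint]
      at heq
    -- A single width at which the Gaussian energy vanishes is enough.
    obtain ⟨s, hs, hs0⟩ : ∃ s : ℝ, 0 < s ∧ energyOfDifference (gaussianKernel s) μ ν = 0 := by
      have : (ae (volume.restrict (Ioi (0 : ℝ)))).NeBot := by
        rw [ae_neBot]; simp
      obtain ⟨s, h1, hs⟩ := (heq.and (ae_restrict_mem measurableSet_Ioi)).exists
      exact ⟨s, hs, (mul_eq_zero.1 h1).resolve_left (Real.rpow_pos_of_pos hs _).ne'⟩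
    exact ext_of_integral_gaussianKernel hs
      (integral_gaussianKernel_eq_of_energyOfDifference_eq_zero hs.le hs0)
  · rintro rfl
    simp [energyOfDifference]

end Power

/-! ### Pull-backs -/

/-- Strong negative type passes to pull-backs along maps that induce the measurable structure. -/
lemma IsOfStrongNegativeType.comp {X Y : Type*} [mX : MeasurableSpace X] [mY : MeasurableSpace Y]
    {d : Y → Y → ℝ} (hd : IsOfStrongNegativeType d)
    (hmeas : Measurable fun p : Y × Y => d p.1 p.2) {f : X → Y} (hf : mX = mY.comap f) :
    IsOfStrongNegativeType fun x x' => d (f x) (f x') := by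
  have hfm : Measurable f := by
    rw [measurable_iff_comap_le, hf]
  have hmut (μ ν : Measure X) [IsProbabilityMeasure μ] [IsProbabilityMeasure ν] :
      mutualEnergy (fun x x' => d (f x) (f x')) μ ν = mutualEnergy d (μ.map f) (ν.map f) := by
    rw [mutualEnergy, mutualEnergy, Measure.map_prod_map _ _ hfm hfm,
      integral_map (by fun_prop) hmeas.aestronglyMeasurable]
    rfl
  have hmom (μ : Measure X) (h : HasFiniteFirstMoment (fun x x' => d (f x) (f x')) μ) :
      HasFiniteFirstMoment d (μ.map f) := by
    obtain ⟨x₀, hx₀⟩ := h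
    refine ⟨f x₀, (integrable_map_measure ?_ hfm.aemeasurable).2 hx₀⟩
    exact (hmeas.comp measurable_prodMk_right).aestronglyMeasurable
  refine ⟨hd.1.comp f, fun μ ν _ _ hμ hν => ⟨fun h => ?_, ?_⟩⟩
  · have := Measure.isProbabilityMeasure_map (μ := μ) hfm.aemeasurable
    have := Measure.isProbabilityMeasure_map (μ := ν) hfm.aemeasurable
    have key : μ.map f = ν.map f := by
      refine (hd.2 _ _ (hmom μ hμ) (hmom ν hν)).1 ?_
      simpa only [energyOfDifference, hmut] using h
    refine Measure.ext fun t ht => ?_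
    rw [hf] at ht
    obtain ⟨t', ht', rfl⟩ := ht
    rw [← Measure.map_apply hfm ht', key, Measure.map_apply hfm ht']
  · rintro rfl
    simp [energyOfDifference]

theorem mainTheorem8 {𝕜 : Type*} [RCLike 𝕜] {H : Type*} [NormedAddCommGroup H]
    [InnerProductSpace 𝕜 H] [CompleteSpace H] [TopologicalSpace.SeparableSpace H]
    [MeasurableSpace H] [BorelSpace H] :
    ((∀ β : ℝ, 0 < β → β ≤ 2 → IsOfNegativeType (fun x y : H => ‖x - y‖ ^ β)) ∧
      (∀ β : ℝ, 0 < β → β < 2 → IsOfStrongNegativeType (fun x y : H => ‖x - y‖ ^ β))) ∧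
    (∀ (X : Type*) [MetricSpace X] [MeasurableSpace X] [BorelSpace X],
      (∃ f : X → H, Isometry f) →
        (∀ β : ℝ, 0 < β → β ≤ 2 → IsOfNegativeType (fun x y : X => dist x y ^ β)) ∧
        (∀ β : ℝ, 0 < β → β < 2 → IsOfStrongNegativeType (fun x y : X => dist x y ^ β))) := by
  -- The statement only involves the norm, so scalars may be restricted to `ℝ`.
  let : InnerProductSpace ℝ H := InnerProductSpace.rclikeToReal 𝕜 H
  have : SecondCountableTopology H := UniformSpace.secondCountable_of_separable H
  refine ⟨⟨fun β h0 h2 => isOfNegativeType_norm_sub_rpow h0 h2,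
    fun β h0 h2 => isOfStrongNegativeType_norm_sub_rpow h0 h2⟩, ?_⟩
  rintro X _ mX _ ⟨f, hf⟩
  simp only [← hf.dist_eq, dist_eq_norm]
  refine ⟨fun β h0 h2 => (isOfNegativeType_norm_sub_rpow h0 h2).comp f,
    fun β h0 h2 => (isOfStrongNegativeType_norm_sub_rpow h0 h2).comp
      (measurable_norm_sub_rpow β) ?_⟩
  -- An isometry is a topological embedding, so it induces the Borel structure.
  rw [BorelSpace.measurable_eq (α := X), BorelSpace.measurable_eq (α := H),
    hf.isEmbedding.eq_induced, borel_comap]
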